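/- **Setting.** A *non-branching algorithm* in $n$ real variables is a finite directed acyclic graph whose sources are the variables $x_1,\dots,x_n$ and whose computational nodes each have two inputs (sources or earlier nodes, possibly negated exactly). Node number $i$ computes $(a\circ b)(1+\delta_i)$ with $\circ\in\{+,-,\times\}$; no constants are available. One (possibly negated) source or node is the output, denoted $p_{comp}(x,\delta)$. The algorithm *evaluates $p\in\mathbb R[x_1,\dots,x_n]$ accurately on $\mathbb R^n$* if for every $0<\theta<1$ there is $0<\epsilon<1$ such that $|p_{comp}(x,\delta)-p(x)|\le\theta|p(x)|$ for all $x\in\mathbb R^n$ and all $\delta$ with $|\delta_i|\le\epsilon$ for all $i$. A *standard change of variables* $C$ splits the variables into groups, chooses a representative in each group, and sets $\tilde x_h=x_h$ for a representative $h$ and $\tilde x_r=x_r-\sigma_r x_h$, with $\sigma_r=\pm1$, for each other member $r$ of the group of $h$. It is *associated with* an irreducible component $Z$ of the real variety $V(p)=\{x\in\mathbb R^n: p(x)=0\}$ if $Z=\{x:\tilde x_i=0\text{ for all }i\in K\}$ for some $K\subseteq\{1,\dots,n\}$. Write $p$ in the new variables as $$p=\sum_{\lambda\in\Lambda}\tilde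 x_K^{\lambda}\,q_\lambda(\tilde x_{K^c}),\qquad q_\lambda\ne0,\quad \Lambda\subset\mathbb Z_{\ge0}^K .$$ Let $\Lambda_j\subseteq\Lambda$ be nonempty and such that $\operatorname{conv}\Lambda_j$ is a face of the Newton polytope $\operatorname{conv}\Lambda$ and the negative of the normal cone of this face meets $\mathbb R^K_{\ge0}$ not only at $0$. Let $S_{\Lambda_j}$ be the set of $\eta\in\mathbb R^K_{\ge 0}$ such that $\eta\cdot\lambda_1=\eta\cdot\lambda_2<\eta\cdot\lambda$ for all $\lambda_1,\lambda_2\in\Lambda_j$ and $\lambda\in\Lambda\setminus\Lambda_j$. The corresponding *dominant term* is $$p_{dom_j,C}=\sum_{\lambda\in\Lambda_j}\tilde x_K^{\lambda}\,q_\lambda(\tilde x_{K^c}),$$ expressed in the original variables. Put $\eta_i=0$ for $i\notin K$. We say that $\eta$ satisfies the *exponent condition* if $\eta_h\le\eta_r$ whenever $h$ is the representative of the group of $r$. *Pruning* an algorithm with respect to $C$ and such an $\eta$: substitute $t^{\eta_i}\tilde x_i$ for each new variable $\tilde x_i$, so that $x_h=t^{\eta_h}\tilde x_h$ for a representative $h$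 and $x_r=t^{\eta_r}\tilde x_r+\sigma_r t^{\eta_h}\tilde x_h$ for the other members $r$ of its group. Let the *order* of a source or node be the lowest exponent of $t$ that occurs in its value, as a formal expression in $\tilde x$, $\delta$ and powers of $t$ ($+\infty$ if the value is identically zero). Process the nodes starting from the sources. A multiplication node is kept, with its in-edges redirected where necessary. A node that adds or subtracts two inputs of different orders is deleted, and its out-edges are redirected to the input of lower order (negated if that input is the subtrahend). A node that adds or subtracts two inputs of equal order is kept, with its in-edges redirected where necessary. A source $x_r$ is replaced by $\sigma_r x_h$, where $h$ is the representative of its group, in every place where its part $t^{\eta_r}\tilde x_r$ is negligible. This means that $\eta_r$ exceeds the order of the result, if $x_r$ is used in an addition or subtraction node that is kept, and that $\eta_r$ exceeds the order of $x_r$ itself in all other cases. Finally, all nodes that no longer lead to the output are deleted. **Theorem.** Let $p\in\mathbb R[x_1,\dots,x_n]$. 1. Suppose that a non-branching algorithm evaluates $p$ accurately on $\mathbb R^n$ by computing $p_{comp}(x,\delta)$. Let $C$ be a standard change of variables associated with an irreducible component of $V(p)$, let $p_{dom_j,C}$ be one of the corresponding dominant terms, and let $\eta\in S_{\Lambda_j}$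 satisfy the exponent condition. Then the algorithm pruned with respect to $C$ and $\eta$ evaluates $p_{dom_j,C}$ accurately on $\mathbb R^n$. 2. Consequently, if some non-branching algorithm evaluates $p$ accurately on $\mathbb R^n$, then for all irreducible components of $V(p)$, all associated standard changes of variables $C$, and all $\Lambda_j$ as above for which some $\eta\in S_{\Lambda_j}$ satisfies the exponent condition, the dominant term $p_{dom_j,C}$ can be evaluated accurately on $\mathbb R^n$ by a non-branching algorithm. -/

import Mathlib

namespace AccurateEval

/-! ### Non-branching algorithms in traditional arithmetic -/

/-- The three basic rounded operations. Negation is exact and is carried by the edges. -/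
inductive Op
  | add
  | sub
  | mul

/-- The exact result of a basic operation. -/
def Op.apply {R : Type*} [CommRing R] : Op → R → R → R
  | .add, u, v => u + v
  | .sub, u, v => u - v
  | .mul, u, v => u * v

/-- An edge of the graph: it starts at the source `x_i` or at a computational node `j`, and may be
exactly negated (`s = -1`). There are no constants. -/
inductive Operand (n k : ℕ)
  | source (s : ℤˣ) (i : Fin n)
  | node (s : ℤˣ) (j : Fin k)

/-- A directed acyclic graph with `k` computational nodes, listed in a topological order. Each node
has two inputs, each of which is a source or an earlier node, up to exact negation. -/
inductive DAG (n : ℕ) : ℕ → Type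
  | empty : DAG n 0
  | snoc {k : ℕ} (G : DAG n k) (o : Op) (a b : Operand n k) : DAG n (k + 1)

/-- The value carried by an edge, given the inputs `x` and the values `v` of the nodes. -/
def Operand.value {R : Type*} [CommRing R] {n k : ℕ} (x : Fin n → R) (v : Fin k → R) :
    Operand n k → R
  | .source s i => ((s : ℤ) : R) * x i
  | .node s j => ((s : ℤ) : R) * v j

/-- The values of all nodes: the node number `k` computes `op(a, b) * (1 + δ k)`. Only the errors
`δ j` with `j` a node of the graph are used. -/
def DAG.values {R : Type*} [CommRing R] {n : ℕ} (x : Fin n → R) (δ : ℕ → R) :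
    {k : ℕ} → DAG n k → Fin k → R
  | _, .empty => fun j => j.elim0
  | k + 1, .snoc G o a b =>
      Fin.snoc (α := fun _ => R) (G.values x δ)
        (o.apply (a.value x (G.values x δ)) (b.value x (G.values x δ)) * (1 + δ k))

/-- A non-branching algorithm: a graph together with the edge leading to the output. -/
structure Algorithm (n : ℕ) where
  size : ℕ
  dag : DAG n size
  out : Operand n size

/-- The computed output `p_comp(x, δ)`. -/
def Algorithm.comp {R : Type*} [CommRing R] {n : ℕ} (A : Algorithm n) (x : Fin n → R)
    (δ : ℕ → R) : R :=
  A.out.value x (A.dag.values x δ)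

/-- `A` evaluates `p` accurately on `D`. (Taking `δ = 0`, this contains the requirement that the
output is exactly `p x` in the absence of rounding errors.) -/
def Algorithm.IsAccurate {n : ℕ} (A : Algorithm n) (p : MvPolynomial (Fin n) ℝ)
    (D : Set (Fin n → ℝ)) : Prop :=
  ∀ η : ℝ, 0 < η → η < 1 → ∃ ε : ℝ, 0 < ε ∧ ε < 1 ∧
    ∀ x ∈ D, ∀ δ : ℕ → ℝ, (∀ i, |δ i| ≤ ε) →
      |A.comp x δ - MvPolynomial.eval x p| ≤ η * |MvPolynomial.eval x p|

/-- `p` can be evaluated accurately on `D` by some non-branching algorithm. -/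
def AccuratelyEvaluable {n : ℕ} (p : MvPolynomial (Fin n) ℝ) (D : Set (Fin n → ℝ)) : Prop :=
  ∃ A : Algorithm n, A.IsAccurate p D

/-! ### Irreducible components of the real variety -/

/-- The real variety `V(p)`. -/
def variety {n : ℕ} (p : MvPolynomial (Fin n) ℝ) : Set (Fin n → ℝ) :=
  {x | MvPolynomial.eval x p = 0}

def IsZariskiClosed {n : ℕ} (Z : Set (Fin n → ℝ)) : Prop :=
  ∃ I : Set (MvPolynomial (Fin n) ℝ), Z = {x | ∀ f ∈ I, MvPolynomial.eval x f = 0}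

/-- Nonempty Zariski-closed sets which are not the union of two proper Zariski-closed subsets. -/
def IsIrreducibleVariety {n : ℕ} (Z : Set (Fin n → ℝ)) : Prop :=
  IsZariskiClosed Z ∧ Z.Nonempty ∧
    ∀ Z₁ Z₂ : Set (Fin n → ℝ), IsZariskiClosed Z₁ → IsZariskiClosed Z₂ →
      Z ⊆ Z₁ ∪ Z₂ → Z ⊆ Z₁ ∨ Z ⊆ Z₂

/-- The irreducible components of `V(p)`: its maximal irreducible subvarieties. -/
def IsIrreducibleComponent {n : ℕ} (p : MvPolynomial (Fin n) ℝ) (Z : Set (Fin n → ℝ)) : Prop :=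
  Maximal (fun W => IsIrreducibleVariety W ∧ W ⊆ variety p) Z

/-! ### Standard changes of variables -/

/-- A standard change of variables. The variables are split into groups (the fibres of `head`), each
with a representative (the fixed points of `head`); the representative is left unchanged and every
other variable `x_r` of the group is replaced by `x_r - σ_r x_{head r}` with `σ_r = ±1`. -/
structure StdChange (n : ℕ) where
  head : Fin n → Fin n
  head_head : ∀ i, head (head i) = head i
  sign : Fin n → ℤˣ

/-- The new variables in terms of the original ones. -/
def StdChange.toNew {R : Type*} [CommRing R] {n : ℕ} (C : StdChange n) (x : Fin n → R) :
    Fin n → R :=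
  fun i => if C.head i = i then x i else x i - ((C.sign i : ℤ) : R) * x (C.head i)

/-- The original variables in terms of the new ones. -/
def StdChange.toOld {R : Type*} [CommRing R] {n : ℕ} (C : StdChange n) (y : Fin n → R) :
    Fin n → R :=
  fun i => if C.head i = i then y i else y i + ((C.sign i : ℤ) : R) * y (C.head i)

/-- `C` is associated with `Z`: in the new variables `Z` is the coordinate subspace on which the
variables with index in `K` vanish. -/
def StdChange.Straightens {n : ℕ} (C : StdChange n) (Z : Set (Fin n → ℝ)) (K : Finset (Fin n)) :
    Prop :=
  Z = {x | ∀ i ∈ K, C.toNew x i = 0}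

/-- The polynomial `p` written in the new variables. -/
noncomputable def StdChange.newPoly {n : ℕ} (C : StdChange n) (p : MvPolynomial (Fin n) ℝ) :
    MvPolynomial (Fin n) ℝ :=
  MvPolynomial.aeval (C.toOld MvPolynomial.X) p

/-- A polynomial in the new variables, written in the original ones. -/
noncomputable def StdChange.oldPoly {n : ℕ} (C : StdChange n) (q : MvPolynomial (Fin n) ℝ) :
    MvPolynomial (Fin n) ℝ :=
  MvPolynomial.aeval (C.toNew MvPolynomial.X) q

/-! ### Dominant terms -/

/-- The exponent vector of a monomial with respect to the variables in `K`. -/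
def expo {n : ℕ} (K : Finset (Fin n)) (m : Fin n →₀ ℕ) : K → ℕ := fun i => m i

/-- The set `Λ` of the exponent vectors of `q` with respect to the variables in `K`. -/
def exponents {n : ℕ} (K : Finset (Fin n)) (q : MvPolynomial (Fin n) ℝ) : Finset (K → ℕ) :=
  q.support.image (expo K)

/-- The convex hull in `ℝ^K` of a set of exponent vectors. For `exponents K q` this is the Newton
polytope of `q` with respect to the variables in `K`. -/
def hull {n : ℕ} {K : Finset (Fin n)} (Λ : Finset (K → ℕ)) : Set (K → ℝ) :=
  convexHull ℝ ((fun (l : K → ℕ) (i : K) => (l i : ℝ)) '' (Λ : Set (K → ℕ)))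

/-- The normal cone of the face `F` of `P`: the vectors whose dot product is maximal over `P` at all
points of `F`. -/
def normalCone {n : ℕ} {K : Finset (Fin n)} (P F : Set (K → ℝ)) : Set (K → ℝ) :=
  {ν | ∀ x ∈ F, ∀ y ∈ P, ∑ i, ν i * y i ≤ ∑ i, ν i * x i}

/-- `Λj ⊆ Λ` determines a nonempty face of the Newton polytope, and the negative of the normal cone
of that face meets the nonnegative orthant not only at the origin. -/
def IsDominantSet {n : ℕ} (K : Finset (Fin n)) (q : MvPolynomial (Fin n) ℝ)
    (Λj : Finset (K → ℕ)) : Prop :=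
  Λj ⊆ exponents K q ∧ Λj.Nonempty ∧
    IsExposed ℝ (hull (exponents K q)) (hull Λj) ∧
    ∃ η : K → ℝ, η ≠ 0 ∧ 0 ≤ η ∧ -η ∈ normalCone (hull (exponents K q)) (hull Λj)

/-- The region `S_{Λj}` of the nonnegative orthant. -/
def region {n : ℕ} (K : Finset (Fin n)) (q : MvPolynomial (Fin n) ℝ) (Λj : Finset (K → ℕ)) :
    Set (K → ℝ) :=
  {η | 0 ≤ η ∧
    (∀ l₁ ∈ Λj, ∀ l₂ ∈ Λj, ∑ i, η i * (l₁ i : ℝ) = ∑ i, η i * (l₂ i : ℝ)) ∧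
    (∀ l₁ ∈ Λj, ∀ l ∈ exponents K q \ Λj, ∑ i, η i * (l₁ i : ℝ) < ∑ i, η i * (l i : ℝ))}

/-- The part of `q` consisting of the terms whose exponent vector with respect to the variables in
`K` lies in `Λj`. -/
noncomputable def domPart {n : ℕ} (K : Finset (Fin n)) (q : MvPolynomial (Fin n) ℝ)
    (Λj : Finset (K → ℕ)) : MvPolynomial (Fin n) ℝ :=
  ∑ m ∈ q.support with expo K m ∈ Λj, MvPolynomial.monomial m (q.coeff m)

/-- The dominant term `p_{dom_j, C}`, in the original variables. -/
noncomputable def domTerm {n : ℕ} (p : MvPolynomial (Fin n) ℝ) (C : StdChange n)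
    (K : Finset (Fin n)) (Λj : Finset (K → ℕ)) : MvPolynomial (Fin n) ℝ :=
  C.oldPoly (domPart K (C.newPoly p) Λj)

/-- A vector `η` indexed by the variables of `K` is viewed as indexed by all the variables. -/
def extend {n : ℕ} {K : Finset (Fin n)} (η : K → ℝ) : Fin n → ℝ :=
  fun i => if h : i ∈ K then η ⟨i, h⟩ else 0

/-- The exponent condition: within each group the representative has the smallest exponent. -/
def ExpCond {n : ℕ} (C : StdChange n) (w : Fin n → ℝ) : Prop :=
  ∀ i, w (C.head i) ≤ w i

/-! ### Pruning

The new variables are scaled as `t ^ w_i * y_i` with `t → 0`, so that the original variable `x_r` is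
`t ^ w_r * y_r + σ_r * t ^ w_h * y_h` where `h = head r` (and `t ^ w_h * y_h` if `r = h`). Each edge
of the graph then carries a polynomial in the `y_i` and the errors, with powers of `t`. -/

/-- The lowest exponent of `t` that occurs in `f(y, δ)` when each `y_i` is replaced by
`t ^ w_i * y_i`, with the value `⊤` for `f = 0`. -/
noncomputable def tOrder {n : ℕ} (w : Fin n → ℝ) (f : MvPolynomial (Fin n ⊕ ℕ) ℝ) : WithTop ℝ :=
  f.support.inf fun m => ((Finsupp.weight (Sum.elim w (fun _ => 0)) m : ℝ) : WithTop ℝ)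

/-- The original variables as formal expressions in the new ones. -/
noncomputable def formalInput {n : ℕ} (C : StdChange n) : Fin n → MvPolynomial (Fin n ⊕ ℕ) ℝ :=
  C.toOld fun i => MvPolynomial.X (Sum.inl i)

/-- The formal values of the nodes of a graph. -/
noncomputable def DAG.formalValues {n k : ℕ} (C : StdChange n) (G : DAG n k) :
    Fin k → MvPolynomial (Fin n ⊕ ℕ) ℝ :=
  G.values (formalInput C) fun j => MvPolynomial.X (Sum.inr j)

/-- The order in `t` of the formal value carried by an edge. -/
noncomputable def DAG.edgeOrder {n k : ℕ} (C : StdChange n) (w : Fin n → ℝ) (G : DAG n k)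
    (a : Operand n k) : WithTop ℝ :=
  tOrder w (a.value (formalInput C) (G.formalValues C))

/-- Multiplication of an edge by a sign. -/
def Operand.signed {n k : ℕ} (s : ℤˣ) : Operand n k → Operand n k
  | .source s' i => .source (s * s') i
  | .node s' j => .node (s * s') j

/-- The same edge in a graph with one more node. -/
def Operand.lift {n k : ℕ} : Operand n k → Operand n (k + 1)
  | .source s i => .source s i
  | .node s j => .node s j.castSucc

/-- The nodes that an edge refers to. -/
def Operand.nodes {n k : ℕ} : Operand n k → Set (Fin k)
  | .source _ _ => ∅
  | .node _ j => {j}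

/-- The result of pruning a graph with `k` nodes: a new graph, and for each of the old nodes the
place to which its out-edges are redirected. -/
structure Pruned (n k : ℕ) where
  size : ℕ
  dag : DAG n size
  redirect : Fin k → Operand n size

open Classical in
/-- Redirection of an edge, where the terms of order above `τ` are negligible: an edge from a node
is redirected together with the node; a source `x_r` whose own contribution `t ^ w_r * y_r` is of
order above `τ` is replaced by its remaining part `σ_r x_h` with `h = head r`. -/
noncomputable def Pruned.edge {n k : ℕ} (P : Pruned n k) (C : StdChange n) (w : Fin n → ℝ)
    (τ : WithTop ℝ) : Operand n k → Operand n P.size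
  | .source s i =>
      if ((w i : ℝ) : WithTop ℝ) ≤ τ then .source s i else .source (s * C.sign i) (C.head i)
  | .node s j => (P.redirect j).signed s

/-- Delete the next node and redirect its out-edges to `c`. -/
def Pruned.delete {n k : ℕ} (P : Pruned n k) (c : Operand n P.size) : Pruned n (k + 1) where
  size := P.size
  dag := P.dag
  redirect := Fin.snoc (α := fun _ => Operand n P.size) P.redirect c

/-- Keep the next node, with the inputs `a` and `b`. -/
def Pruned.keep {n k : ℕ} (P : Pruned n k) (o : Op) (a b : Operand n P.size) :
    Pruned n (k + 1) where
  size := P.size + 1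
  dag := P.dag.snoc o a b
  redirect := Fin.snoc (α := fun _ => Operand n (P.size + 1)) (fun j => (P.redirect j).lift)
    (.node 1 (Fin.last P.size))

open Classical in
/-- Pruning. `L` is the set of nodes that are still needed further on.

* A node that is no longer needed is deleted (nothing refers to it, so that the redirection of
  its out-edges is immaterial).
* A multiplication is kept, with its in-edges redirected.
* An addition or subtraction of two inputs of different orders in `t` is deleted, and its out-edges
  are redirected to the dominating input, the one with the lower order (negated, if it is the
  second input of a subtraction).
* An addition or subtraction of two inputs of equal order is kept, with its in-edges redirected;
  terms of order above that of the sum or difference are negligible there. (If the leading terms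
  of two sources of a group cancel, then this order exceeds that of the sources.) -/
noncomputable def DAG.prune {n : ℕ} (C : StdChange n) (w : Fin n → ℝ) :
    {k : ℕ} → DAG n k → Set (Fin k) → Pruned n k
  | _, .empty, _ => ⟨0, .empty, fun j => j.elim0⟩
  | k + 1, .snoc G o a b, L =>
      let L₀ : Set (Fin k) := {j | j.castSucc ∈ L}
      let α := G.edgeOrder C w a
      let β := G.edgeOrder C w b
      let Pa := G.prune C w (L₀ ∪ a.nodes)
      let Pb := G.prune C w (L₀ ∪ b.nodes)
      let Pab := G.prune C w (L₀ ∪ a.nodes ∪ b.nodes)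
      let γ := (G.snoc o a b).edgeOrder C w (.node 1 (Fin.last k))
      if Fin.last k ∈ L then
        match o with
        | .mul => Pab.keep .mul (Pab.edge C w α a) (Pab.edge C w β b)
        | .add =>
            if α < β then Pa.delete (Pa.edge C w α a)
            else if β < α then Pb.delete (Pb.edge C w β b)
            else Pab.keep .add (Pab.edge C w γ a) (Pab.edge C w γ b)
        | .sub =>
            if α < β then Pa.delete (Pa.edge C w α a)
            else if β < α then Pb.delete ((Pb.edge C w β b).signed (-1))
            else Pab.keep .sub (Pab.edge C w γ a) (Pab.edge C w γ b)
      else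
        let P := G.prune C w L₀
        P.delete (P.edge C w α a)

/-- The pruned algorithm, with output `p_{dom_j, C, comp}(x, δ)`, for the exponents `w` of `t`. -/
noncomputable def Algorithm.prune {n : ℕ} (A : Algorithm n) (C : StdChange n) (w : Fin n → ℝ) :
    Algorithm n :=
  let P := A.dag.prune C w A.out.nodes
  ⟨P.size, P.dag, P.edge C w (A.dag.edgeOrder C w A.out) A.out⟩

end AccurateEval

/-! Scale the new variables as `t ^ w_i * y_i` and let `t → 0`. For suitably chosen errors in the
original graph, the pruned algorithm computes exactly the terms of lowest order in `t` of the
original formal output (`Algorithm.exists_prune_comp_eq`). Each kept node passes its error back to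
the node it comes from and all other nodes get error 0, so the bound `ε` is preserved.

The invariant, proved by induction on the graph, is that every redirected node still needed carries
the leading part of its formal value. Leading parts are multiplicative because real polynomials have
no zero divisors, and in a sum of unequal orders the lower one wins. For equal orders the danger is
cancellation. A node contains the factor `1 + δ_j`, so it vanishes at `δ_j = -1`, while sources and
earlier nodes do not involve `δ_j`; hence the leading parts cannot cancel (`tOrder_add_of_freeOf`).
Two edges from one node are proportional, and two sources are truncated at the order of their sum,
which allows for cancellation.

Accuracy then passes to the limit (`abs_leadPart_sub_le`): the dominant term is the lowest-order
part of `p`, of order `μ` say, and the accuracy inequality multiplied by `t ^ (-μ)` tends to the one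
for the leading parts. Accuracy also forces the output to have the same order `μ`. -/

namespace AccurateEval

open MvPolynomial Filter Topology

/-! ### Truncation by weight and leading parts -/

section Truncation

variable {σ : Type*} (W : σ → ℝ)

open Classical in
/-- The terms of `f` of weight at most `τ`. -/
noncomputable def truncate (τ : WithTop ℝ) (f : MvPolynomial σ ℝ) : MvPolynomial σ ℝ :=
  ∑ m ∈ f.support with ((Finsupp.weight W m : ℝ) : WithTop ℝ) ≤ τ, monomial m (f.coeff m)

open Classical in
theorem coeff_truncate (τ : WithTop ℝ) (f : MvPolynomial σ ℝ) (m : σ →₀ ℕ) :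
    (truncate W τ f).coeff m =
      if ((Finsupp.weight W m : ℝ) : WithTop ℝ) ≤ τ then f.coeff m else 0 := by
  unfold truncate
  rw [coeff_sum]
  simp only [coeff_monomial, Finset.sum_ite_eq', Finset.mem_filter, mem_support_iff]
  split_ifs <;> simp_all

theorem truncate_add (τ : WithTop ℝ) (f g : MvPolynomial σ ℝ) :
    truncate W τ (f + g) = truncate W τ f + truncate W τ g := by
  classical
  ext m
  simp only [coeff_truncate, coeff_add]
  split_ifs <;> simp

theorem truncate_C_mul (τ : WithTop ℝ) (c : ℝ) (f : MvPolynomial σ ℝ) :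
    truncate W τ (C c * f) = C c * truncate W τ f := by
  classical
  ext m
  simp only [coeff_truncate, coeff_C_mul]
  split_ifs <;> simp

theorem truncate_zero (τ : WithTop ℝ) : truncate W τ (0 : MvPolynomial σ ℝ) = 0 := by
  simp [truncate]

theorem truncate_X (τ : WithTop ℝ) (i : σ) [Decidable ((W i : WithTop ℝ) ≤ τ)] :
    truncate W τ (X i) = if (W i : WithTop ℝ) ≤ τ then X i else 0 := by
  classical
  ext m
  have h : (Finsupp.weight W (Finsupp.single i 1) : ℝ) = W i := by
    simp [Finsupp.weight_apply]
  rw [coeff_truncate, coeff_X]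
  by_cases hm : Finsupp.single i 1 = m
  · subst hm
    rw [h]
    split_ifs <;> simp_all
  · split_ifs <;> simp_all [coeff_X]

/-- The point `z` with its coordinates scaled by powers of `t`. -/
noncomputable def scale (t : ℝ) (z : σ → ℝ) : σ → ℝ := fun i => t ^ W i * z i

theorem prod_scale {t : ℝ} (ht : 0 < t) (z : σ → ℝ) (m : σ →₀ ℕ) :
    (m.prod fun i e => scale W t z i ^ e) =
      t ^ (Finsupp.weight W m : ℝ) * m.prod fun i e => z i ^ e := by
  rw [Finsupp.weight_apply, Finsupp.sum, Real.rpow_sum_of_pos ht, Finsupp.prod, Finsupp.prod,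
    ← Finset.prod_mul_distrib]
  refine Finset.prod_congr rfl fun i _ => ?_
  rw [scale, mul_pow, ← Real.rpow_natCast, ← Real.rpow_mul ht.le, nsmul_eq_mul, mul_comm (W i)]

theorem tendsto_rpow_nhdsGT_zero {c : ℝ} (hc : 0 < c) :
    Tendsto (fun t : ℝ => t ^ c) (𝓝[>] 0) (𝓝 0) := by
  have h := (Real.continuousAt_rpow_const 0 c (Or.inr hc.le)).tendsto
  rw [Real.zero_rpow hc.ne'] at h
  exact h.mono_left nhdsWithin_le_nhds

/-- A term of weight `W m` acquires the factor `t ^ (W m - μ)`, which is constant for `W m = μ` and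
tends to 0 for larger weights. No smaller weight occurs, so truncation at `μ` keeps exactly the
surviving terms. -/
theorem tendsto_eval_scale (f : MvPolynomial σ ℝ) (μ : ℝ)
    (h : ∀ m ∈ f.support, μ ≤ Finsupp.weight W m) (z : σ → ℝ) :
    Tendsto (fun t : ℝ => t ^ (-μ) * eval (scale W t z) f) (𝓝[>] 0)
      (𝓝 (eval z (truncate W μ f))) := by
  classical
  have key : ∀ m ∈ f.support, Tendsto
      (fun t : ℝ => t ^ (Finsupp.weight W m - μ) * (f.coeff m * m.prod fun i e => z i ^ e))
      (𝓝[>] 0) (𝓝 (if ((Finsupp.weight W m : ℝ) : WithTop ℝ) ≤ μ then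
        eval z (monomial m (f.coeff m)) else 0)) := by
    intro m hm
    rw [eval_monomial]
    rcases (h m hm).eq_or_lt with he | hl
    · simp [← he]
    · rw [if_neg (by rw [WithTop.coe_le_coe]; exact hl.not_ge)]
      have := (tendsto_rpow_nhdsGT_zero (sub_pos.2 hl)).mul_const
        (f.coeff m * m.prod fun i e => z i ^ e)
      rwa [zero_mul] at this
  have hs := tendsto_finsetSum _ key
  rw [← Finset.sum_filter, ← eval_sum] at hs
  refine hs.congr' ?_
  filter_upwards [self_mem_nhdsWithin] with t (ht : 0 < t)
  rw [eval_eq, Finset.mul_sum]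
  refine Finset.sum_congr rfl fun m _ => ?_
  have := prod_scale W ht z m
  rw [Finsupp.prod] at this
  rw [this, sub_eq_neg_add, Real.rpow_add ht]
  ring

end Truncation

/-! ### Leading parts as limits under scaling -/

section LeadingPart

variable {n : ℕ} (w : Fin n → ℝ)

/-- The weights of the new variables and of the errors. -/
abbrev wt : Fin n ⊕ ℕ → ℝ := Sum.elim w fun _ => 0

/-- The terms of `f` of lowest order in `t`. -/
noncomputable def leadPart (f : MvPolynomial (Fin n ⊕ ℕ) ℝ) : MvPolynomial (Fin n ⊕ ℕ) ℝ :=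
  truncate (wt w) (tOrder w f) f

theorem tOrder_zero : tOrder w 0 = ⊤ := by simp [tOrder]

theorem leadPart_zero : leadPart w 0 = 0 := truncate_zero _ _

theorem exists_tOrder_eq {f : MvPolynomial (Fin n ⊕ ℕ) ℝ} (hf : f ≠ 0) :
    ∃ m ∈ f.support, tOrder w f = ((Finsupp.weight (wt w) m : ℝ) : WithTop ℝ) := by
  obtain ⟨m, hm, h⟩ := Finset.exists_mem_eq_inf f.support (support_nonempty.2 hf)
    fun m => ((Finsupp.weight (wt w) m : ℝ) : WithTop ℝ)
  exact ⟨m, hm, h⟩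

theorem tOrder_eq_top {f : MvPolynomial (Fin n ⊕ ℕ) ℝ} : tOrder w f = ⊤ ↔ f = 0 := by
  refine ⟨fun h => ?_, fun h => by rw [h, tOrder_zero]⟩
  by_contra hf
  obtain ⟨m, -, hm⟩ := exists_tOrder_eq w hf
  exact WithTop.coe_ne_top (hm.symm.trans h)

theorem tOrder_le {f : MvPolynomial (Fin n ⊕ ℕ) ℝ} {m} (hm : m ∈ f.support) :
    tOrder w f ≤ ((Finsupp.weight (wt w) m : ℝ) : WithTop ℝ) :=
  Finset.inf_le (f := fun m => ((Finsupp.weight (wt w) m : ℝ) : WithTop ℝ)) hm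

theorem leadPart_ne_zero {f : MvPolynomial (Fin n ⊕ ℕ) ℝ} (hf : f ≠ 0) : leadPart w f ≠ 0 := by
  classical
  obtain ⟨m, hm, h⟩ := exists_tOrder_eq w hf
  rw [ne_zero_iff]
  refine ⟨m, ?_⟩
  rw [leadPart, coeff_truncate, if_pos h.ge]
  exact mem_support_iff.1 hm

/-- `F` describes the limit of `t ^ (-μ) * f` as `t → 0`, where the variables are scaled. -/
def HasLead (f : MvPolynomial (Fin n ⊕ ℕ) ℝ) (μ : ℝ) (F : MvPolynomial (Fin n ⊕ ℕ) ℝ) : Prop :=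
  ∀ z, Tendsto (fun t : ℝ => t ^ (-μ) * eval (scale (wt w) t z) f) (𝓝[>] 0) (𝓝 (eval z F))

variable {w}
variable {f g F G : MvPolynomial (Fin n ⊕ ℕ) ℝ} {μ ν : ℝ}

theorem hasLead_leadPart (h : tOrder w f = μ) : HasLead w f μ (leadPart w f) := by
  intro z
  rw [leadPart, h]
  refine tendsto_eval_scale _ _ _ (fun m hm => ?_) z
  have := tOrder_le w hm
  rwa [h, WithTop.coe_le_coe] at this

theorem HasLead.mul (hf : HasLead w f μ F) (hg : HasLead w g ν G) :
    HasLead w (f * g) (μ + ν) (F * G) := by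
  intro z
  rw [map_mul]
  refine ((hf z).mul (hg z)).congr' ?_
  filter_upwards [self_mem_nhdsWithin] with t (ht : 0 < t)
  rw [neg_add, Real.rpow_add ht, map_mul]
  ring

theorem HasLead.add (hf : HasLead w f μ F) (hg : HasLead w g μ G) :
    HasLead w (f + g) μ (F + G) := by
  intro z
  rw [map_add]
  refine ((hf z).add (hg z)).congr fun t => ?_
  rw [map_add]
  ring

theorem HasLead.lower (hf : HasLead w f μ F) (h : ν < μ) : HasLead w f ν 0 := by
  intro z
  have := (tendsto_rpow_nhdsGT_zero (sub_pos.2 h)).mul (hf z)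
  rw [zero_mul] at this
  rw [map_zero]
  refine this.congr' ?_
  filter_upwards [self_mem_nhdsWithin] with t (ht : 0 < t)
  rw [← mul_assoc, ← Real.rpow_add ht]
  ring_nf

theorem hasLead_zero : HasLead w 0 μ 0 := by
  intro z
  simp

theorem HasLead.unique (hF : HasLead w f μ F) (hG : HasLead w f μ G) : F = G :=
  MvPolynomial.funext fun z => tendsto_nhds_unique (hF z) (hG z)

/-- A nonzero limit determines the exponent: if the order differed from `μ`, rescaling by the
smaller of the two exponents would give a nonzero limit and the limit 0 at once. -/
theorem HasLead.tOrder_eq (h : HasLead w f μ F) (hF : F ≠ 0) : tOrder w f = μ := by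
  have hf : f ≠ 0 := by
    rintro rfl
    exact hF (h.unique hasLead_zero)
  obtain ⟨m, -, hm⟩ := exists_tOrder_eq w hf
  have hl := hasLead_leadPart hm
  rw [hm]
  rcases lt_trichotomy (Finsupp.weight (wt w) m) μ with hlt | heq | hgt
  · exact absurd (hl.unique (h.lower hlt)) (leadPart_ne_zero w hf)
  · rw [heq]
  · exact absurd (h.unique (hl.lower hgt)) hF

theorem HasLead.leadPart_eq (h : HasLead w f μ F) (hF : F ≠ 0) : leadPart w f = F :=
  (hasLead_leadPart (h.tOrder_eq hF)).unique h

theorem exists_hasLead (hf : f ≠ 0) :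
    ∃ μ : ℝ, tOrder w f = μ ∧ HasLead w f μ (leadPart w f) := by
  obtain ⟨m, -, hm⟩ := exists_tOrder_eq w hf
  exact ⟨_, hm, hasLead_leadPart hm⟩

/-- The product of the two limits is nonzero, since polynomials over a field form a domain, and a
nonzero limit is the leading part. -/
theorem leadPart_mul (f g : MvPolynomial (Fin n ⊕ ℕ) ℝ) :
    leadPart w (f * g) = leadPart w f * leadPart w g := by
  by_cases hf : f = 0
  · simp [hf, leadPart_zero]
  by_cases hg : g = 0
  · simp [hg, leadPart_zero]
  obtain ⟨μ, -, h₁⟩ := exists_hasLead (w := w) hf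
  obtain ⟨ν, -, h₂⟩ := exists_hasLead (w := w) hg
  exact (h₁.mul h₂).leadPart_eq (mul_ne_zero (leadPart_ne_zero w hf) (leadPart_ne_zero w hg))

theorem leadPart_add_of_lt (h : tOrder w f < tOrder w g) :
    leadPart w (f + g) = leadPart w f := by
  have hf : f ≠ 0 := fun h0 => not_top_lt ((tOrder_eq_top w).2 h0 ▸ h)
  by_cases hg : g = 0
  · rw [hg, add_zero]
  obtain ⟨μ, e₁, h₁⟩ := exists_hasLead (w := w) hf
  obtain ⟨ν, e₂, h₂⟩ := exists_hasLead (w := w) hg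
  rw [e₁, e₂, WithTop.coe_lt_coe] at h
  have := h₁.add (h₂.lower h)
  rw [add_zero] at this
  exact this.leadPart_eq (leadPart_ne_zero w hf)

theorem tOrder_add_of_eq (h : tOrder w f = tOrder w g)
    (hne : f ≠ 0 → leadPart w f + leadPart w g ≠ 0) : tOrder w (f + g) = tOrder w f := by
  by_cases hf : f = 0
  · have hg : g = 0 := by rw [← tOrder_eq_top w, ← h, tOrder_eq_top, hf]
    rw [hf, hg, add_zero]
  obtain ⟨μ, e, h₁⟩ := exists_hasLead (w := w) hf
  rw [e, (h₁.add (hasLead_leadPart (h.symm.trans e))).tOrder_eq (hne hf)]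

theorem hasLead_of_weightless (h : ∀ t z, eval (scale (wt w) t z) f = eval z f) :
    HasLead w f 0 f := by
  intro z
  simp [h]

theorem scale_inr (t : ℝ) (z : Fin n ⊕ ℕ → ℝ) (l : ℕ) :
    scale (wt w) t z (Sum.inr l) = z (Sum.inr l) := by
  simp [scale]

theorem hasLead_one_add_X (l : ℕ) : HasLead w (1 + X (Sum.inr l)) 0 (1 + X (Sum.inr l)) :=
  hasLead_of_weightless fun t z => by simp [scale_inr]

theorem one_add_X_ne_zero (l : ℕ) : (1 + X (Sum.inr l) : MvPolynomial (Fin n ⊕ ℕ) ℝ) ≠ 0 := by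
  intro h
  have := congrArg (eval 0) h
  simp at this

/-- Errors have weight 0, so a rounding factor is its own leading part. -/
theorem leadPart_mul_one_add_X (f : MvPolynomial (Fin n ⊕ ℕ) ℝ) (l : ℕ) :
    leadPart w (f * (1 + X (Sum.inr l))) = leadPart w f * (1 + X (Sum.inr l)) := by
  rw [leadPart_mul, (hasLead_one_add_X l).leadPart_eq (one_add_X_ne_zero l)]

theorem tOrder_mul_one_add_X (f : MvPolynomial (Fin n ⊕ ℕ) ℝ) (l : ℕ) :
    tOrder w (f * (1 + X (Sum.inr l))) = tOrder w f := by
  by_cases hf : f = 0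
  · simp [hf]
  obtain ⟨μ, e, h⟩ := exists_hasLead (w := w) hf
  rw [e, (h.mul (hasLead_one_add_X l)).tOrder_eq
    (mul_ne_zero (leadPart_ne_zero w hf) (one_add_X_ne_zero l)), add_zero]

theorem tOrder_C_mul {c : ℝ} (hc : c ≠ 0) (f : MvPolynomial (Fin n ⊕ ℕ) ℝ) :
    tOrder w (C c * f) = tOrder w f := by
  have : (C c * f).support = f.support := by
    ext m
    simp [hc]
  rw [tOrder, tOrder, this]

theorem leadPart_C_mul (c : ℝ) (f : MvPolynomial (Fin n ⊕ ℕ) ℝ) :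
    leadPart w (C c * f) = C c * leadPart w f := by
  by_cases hc : c = 0
  · simp [hc, leadPart_zero]
  · rw [leadPart, leadPart, tOrder_C_mul hc, truncate_C_mul]

/-! ### Dependence on a single error -/

/-- The value of `f` does not depend on the error number `l`. -/
def FreeOf (l : ℕ) (f : MvPolynomial (Fin n ⊕ ℕ) ℝ) : Prop :=
  ∀ z c, eval (Function.update z (Sum.inr l) c) f = eval z f

theorem scale_update (t : ℝ) (z : Fin n ⊕ ℕ → ℝ) (l : ℕ) (c : ℝ) :
    scale (wt w) t (Function.update z (Sum.inr l) c) =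
      Function.update (scale (wt w) t z) (Sum.inr l) c := by
  funext i
  by_cases hi : i = Sum.inr l
  · subst hi
    simp [scale]
  · simp [scale, hi]

/-- Scaling leaves the errors alone and so commutes with changing one of them; the independence
passes to the limit. -/
theorem FreeOf.leadPart {l : ℕ} (h : FreeOf l f) : FreeOf l (leadPart w f) := by
  by_cases hf : f = 0
  · intro z c
    simp [hf, leadPart_zero]
  obtain ⟨μ, -, hl⟩ := exists_hasLead (w := w) hf
  intro z c
  refine tendsto_nhds_unique (hl _) ((hl z).congr fun t => ?_)
  rw [scale_update, h]

theorem eval_leadPart_eq_zero {l : ℕ} (h : ∀ z, z (Sum.inr l) = -1 → eval z f = 0)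
    {z : Fin n ⊕ ℕ → ℝ} (hz : z (Sum.inr l) = -1) : eval z (leadPart w f) = 0 := by
  by_cases hf : f = 0
  · simp [hf, leadPart_zero]
  obtain ⟨μ, -, hl⟩ := exists_hasLead (w := w) hf
  refine tendsto_nhds_unique (hl z) (tendsto_const_nhds.congr fun t => ?_)
  rw [h _ (by rw [scale_inr, hz]), mul_zero]

/-- The reason why rounded values do not cancel. Here `f` is a node with error `l` and `g` does not
see that error. At `δ_l = -1` the leading part of `f` vanishes, so cancellation would make that of
`g` vanish there, hence everywhere. The value `-1` enters only in this polynomial identity, so it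
need not respect the error bound. -/
theorem tOrder_add_of_freeOf {l : ℕ} (h : ∀ z, z (Sum.inr l) = -1 → eval z f = 0)
    (hg : FreeOf l g) (he : tOrder w f = tOrder w g) : tOrder w (f + g) = tOrder w f := by
  refine tOrder_add_of_eq he fun hf hsum => ?_
  refine leadPart_ne_zero w (f := g) ?_ (MvPolynomial.funext fun z => ?_)
  · rwa [Ne, ← tOrder_eq_top w, ← he, tOrder_eq_top]
  · have h₁ : eval (Function.update z (Sum.inr l) (-1)) (leadPart w f) = 0 :=
      eval_leadPart_eq_zero h (by simp)
    have h₂ := congrArg (eval (Function.update z (Sum.inr l) (-1))) hsum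
    rw [map_add, h₁, hg.leadPart, zero_add] at h₂
    exact h₂

end LeadingPart

variable {n : ℕ}

/-! ### Values of graphs under ring homomorphisms -/

section Values

variable {R S : Type*} [CommRing R] [CommRing S] (φ : R →+* S)

theorem Op.map_apply (o : Op) (u v : R) : φ (o.apply u v) = o.apply (φ u) (φ v) := by
  cases o <;> simp [Op.apply]

theorem Operand.map_value {k : ℕ} (a : Operand n k) (x : Fin n → R) (v : Fin k → R) :
    φ (a.value x v) = a.value (fun i => φ (x i)) fun j => φ (v j) := by
  cases a <;> simp [Operand.value]

theorem DAG.map_values {k : ℕ} (G : DAG n k) (x : Fin n → R) (δ : ℕ → R) (j : Fin k) :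
    φ (G.values x δ j) = G.values (fun i => φ (x i)) (fun i => φ (δ i)) j := by
  induction G with
  | empty => exact j.elim0
  | snoc G o a b ih =>
    have ih' : (fun j => φ (G.values x δ j)) =
        G.values (fun i => φ (x i)) fun i => φ (δ i) := funext ih
    refine Fin.lastCases ?_ (fun j => ?_) j
    · simp only [DAG.values, Fin.snoc_last]
      rw [map_mul, Op.map_apply, Operand.map_value, Operand.map_value, ih', map_add, map_one]
    · simp only [DAG.values, Fin.snoc_castSucc]
      exact ih j

theorem DAG.values_congr {k : ℕ} (G : DAG n k) (x : Fin n → R) {δ δ' : ℕ → R} (j : Fin k)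
    (h : ∀ i : ℕ, i ≤ j → δ i = δ' i) : G.values x δ j = G.values x δ' j := by
  induction G with
  | empty => exact j.elim0
  | @snoc k G o a b ih =>
    revert h
    refine Fin.lastCases (fun h => ?_) (fun j h => ?_) j
    · have : G.values x δ = G.values x δ' :=
        funext fun j => ih j fun i hi => h i (hi.trans (Nat.le_of_lt (by simp)))
      simp only [DAG.values, Fin.snoc_last]
      rw [this, h k (by simp)]
    · simp only [DAG.values, Fin.snoc_castSucc]
      exact ih j h

theorem DAG.values_eq_zero {k : ℕ} (G : DAG n k) (x : Fin n → R) {δ : ℕ → R} (j : Fin k)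
    (h : δ j = -1) : G.values x δ j = 0 := by
  induction G with
  | empty => exact j.elim0
  | snoc G o a b ih =>
    revert h
    refine Fin.lastCases (fun h => ?_) (fun j h => ?_) j
    · simp only [Fin.val_last] at h
      simp [DAG.values, h]
    · simp only [DAG.values, Fin.snoc_castSucc]
      exact ih j h

theorem StdChange.map_toOld (C : StdChange n) (y : Fin n → R) (i : Fin n) :
    φ (C.toOld y i) = C.toOld (fun i => φ (y i)) i := by
  simp only [StdChange.toOld]
  split_ifs <;> simp

theorem StdChange.map_toNew (C : StdChange n) (x : Fin n → R) (i : Fin n) :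
    φ (C.toNew x i) = C.toNew (fun i => φ (x i)) i := by
  simp only [StdChange.toNew]
  split_ifs <;> simp

theorem Operand.value_signed {k : ℕ} (s : ℤˣ) (a : Operand n k) (x : Fin n → R)
    (v : Fin k → R) : (a.signed s).value x v = ((s : ℤ) : R) * a.value x v := by
  cases a <;> simp [Operand.value, Operand.signed, mul_assoc]

theorem Operand.value_lift {k : ℕ} (a : Operand n k) (x : Fin n → R) (v : Fin (k + 1) → R) :
    a.lift.value x v = a.value x fun j => v j.castSucc := by
  cases a <;> rfl

theorem DAG.values_snoc_comp_castSucc {k : ℕ} (G : DAG n k) (o : Op) (a b : Operand n k)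
    (x : Fin n → R) (δ : ℕ → R) :
    (fun j : Fin k => (G.snoc o a b).values x δ j.castSucc) = G.values x δ := by
  funext j
  simp [DAG.values]

theorem DAG.values_snoc_last {k : ℕ} (G : DAG n k) (o : Op) (a b : Operand n k)
    (x : Fin n → R) (δ : ℕ → R) :
    (G.snoc o a b).values x δ (Fin.last k) =
      o.apply (a.value x (G.values x δ)) (b.value x (G.values x δ)) * (1 + δ k) := by
  simp [DAG.values]

end Values

/-! ### Formal values -/

/-- The formal value carried by an edge. -/
noncomputable def DAG.formalEdge {k : ℕ} (C : StdChange n) (G : DAG n k) (a : Operand n k) :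
    MvPolynomial (Fin n ⊕ ℕ) ℝ :=
  a.value (formalInput C) (G.formalValues C)

theorem eval_formalInput (Ch : StdChange n) (z : Fin n ⊕ ℕ → ℝ) (i : Fin n) :
    eval z (formalInput Ch i) = Ch.toOld (fun i => z (Sum.inl i)) i := by
  rw [formalInput, StdChange.map_toOld]
  simp

theorem DAG.eval_formalValues {k : ℕ} (Ch : StdChange n) (G : DAG n k) (z : Fin n ⊕ ℕ → ℝ)
    (j : Fin k) : eval z (G.formalValues Ch j) =
      G.values (Ch.toOld fun i => z (Sum.inl i)) (fun l => z (Sum.inr l)) j := by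
  rw [DAG.formalValues, DAG.map_values]
  simp [eval_formalInput]

theorem DAG.eval_formalEdge {k : ℕ} (Ch : StdChange n) (G : DAG n k) (z : Fin n ⊕ ℕ → ℝ)
    (a : Operand n k) : eval z (G.formalEdge Ch a) =
      a.value (Ch.toOld fun i => z (Sum.inl i))
        (G.values (Ch.toOld fun i => z (Sum.inl i)) fun l => z (Sum.inr l)) := by
  rw [DAG.formalEdge, Operand.map_value]
  simp [eval_formalInput, DAG.eval_formalValues]

theorem DAG.formalEdge_source {k : ℕ} (Ch : StdChange n) (G : DAG n k) (s : ℤˣ) (i : Fin n) :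
    G.formalEdge Ch (.source s i) = C ((s : ℤ) : ℝ) * formalInput Ch i := by
  simp [DAG.formalEdge, Operand.value]

theorem DAG.formalEdge_node {k : ℕ} (Ch : StdChange n) (G : DAG n k) (s : ℤˣ) (j : Fin k) :
    G.formalEdge Ch (.node s j) = C ((s : ℤ) : ℝ) * G.formalValues Ch j := by
  simp [DAG.formalEdge, Operand.value]

theorem DAG.formalEdge_signed {k : ℕ} (Ch : StdChange n) (G : DAG n k) (s : ℤˣ)
    (a : Operand n k) : G.formalEdge Ch (a.signed s) = C ((s : ℤ) : ℝ) * G.formalEdge Ch a := by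
  simp [DAG.formalEdge, Operand.value_signed]

theorem DAG.formalValues_snoc_castSucc {k : ℕ} (Ch : StdChange n) (G : DAG n k) (o : Op)
    (a b : Operand n k) (j : Fin k) :
    (G.snoc o a b).formalValues Ch j.castSucc = G.formalValues Ch j := by
  simp [DAG.formalValues, DAG.values]

theorem DAG.formalValues_snoc_last {k : ℕ} (Ch : StdChange n) (G : DAG n k) (o : Op)
    (a b : Operand n k) :
    (G.snoc o a b).formalValues Ch (Fin.last k) =
      o.apply (G.formalEdge Ch a) (G.formalEdge Ch b) * (1 + X (Sum.inr k)) := by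
  simp [DAG.formalValues, DAG.values, DAG.formalEdge]

theorem freeOf_formalValues {k l : ℕ} (Ch : StdChange n) (G : DAG n k) (j : Fin k)
    (h : (j : ℕ) < l) : FreeOf l (G.formalValues Ch j) := by
  intro z c
  simp only [DAG.eval_formalValues, ne_eq, reduceCtorEq, not_false_eq_true,
    Function.update_of_ne]
  refine G.values_congr _ j fun i hi => ?_
  rw [Function.update_of_ne]
  simp only [ne_eq, Sum.inr.injEq]
  omega

theorem freeOf_formalEdge_source {k l : ℕ} (Ch : StdChange n) (G : DAG n k) (s : ℤˣ)
    (i : Fin n) : FreeOf l (G.formalEdge Ch (.source s i)) := by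
  intro z c
  simp [DAG.formalEdge_source, eval_formalInput]

theorem freeOf_formalEdge_node {k l : ℕ} (Ch : StdChange n) (G : DAG n k) (s : ℤˣ) (j : Fin k)
    (h : (j : ℕ) < l) : FreeOf l (G.formalEdge Ch (.node s j)) := by
  intro z c
  simp [DAG.formalEdge_node, freeOf_formalValues Ch G j h z c]

theorem freeOf_formalEdge {k : ℕ} (Ch : StdChange n) (G : DAG n k) (a : Operand n k) :
    FreeOf k (G.formalEdge Ch a) := by
  cases a with
  | source s i => exact freeOf_formalEdge_source Ch G s i
  | node s j => exact freeOf_formalEdge_node Ch G s j j.2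

theorem eval_formalEdge_node_eq_zero {k : ℕ} (Ch : StdChange n) (G : DAG n k) (s : ℤˣ)
    (j : Fin k) (z : Fin n ⊕ ℕ → ℝ) (hz : z (Sum.inr j) = -1) :
    eval z (G.formalEdge Ch (.node s j)) = 0 := by
  rw [DAG.formalEdge_node, map_mul, DAG.eval_formalValues, DAG.values_eq_zero _ _ j hz, mul_zero]

/-! ### Redirected edges -/

variable {Ch : StdChange n} {w : Fin n → ℝ}

theorem le_tOrder_add {τ : WithTop ℝ} {f g : MvPolynomial (Fin n ⊕ ℕ) ℝ} (hf : τ ≤ tOrder w f)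
    (hg : τ ≤ tOrder w g) : τ ≤ tOrder w (f + g) := by
  classical
  refine Finset.le_inf fun m hm => ?_
  rcases Finset.mem_union.1 (support_add hm) with h | h
  · exact hf.trans (tOrder_le w h)
  · exact hg.trans (tOrder_le w h)

theorem tOrder_X_inl (i : Fin n) : tOrder w (X (Sum.inl i)) = w i := by
  simp [tOrder, support_X, Finsupp.weight_apply]

theorem intUnit_cast_ne_zero (s : ℤˣ) : ((s : ℤ) : ℝ) ≠ 0 := by
  exact_mod_cast s.ne_zero

theorem formalInput_eq (Ch : StdChange n) (i : Fin n) :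
    formalInput Ch i = if Ch.head i = i then X (Sum.inl i) else
      X (Sum.inl i) + C ((Ch.sign i : ℤ) : ℝ) * X (Sum.inl (Ch.head i)) := by
  simp [formalInput, StdChange.toOld]

/-- This is where the exponent condition enters: the representative's term has the lowest weight in
`x_r`, so only the variable's own term can be negligible. -/
theorem le_tOrder_formalEdge_source {k : ℕ} (hw : ExpCond Ch w) (G : DAG n k) (s : ℤˣ)
    (i : Fin n) : ((w (Ch.head i) : ℝ) : WithTop ℝ) ≤ tOrder w (G.formalEdge Ch (.source s i)) := by
  rw [DAG.formalEdge_source, tOrder_C_mul (intUnit_cast_ne_zero s), formalInput_eq]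
  split_ifs with h
  · rw [tOrder_X_inl, h]
  · refine le_tOrder_add ?_ ?_
    · rw [tOrder_X_inl]
      exact WithTop.coe_le_coe.2 (hw i)
    · rw [tOrder_C_mul (intUnit_cast_ne_zero _), tOrder_X_inl]

theorem wt_inl (i : Fin n) : wt w (Sum.inl i) = w i := rfl

/-- The hypothesis `h` keeps the representative's term in the truncation, so replacing `x_r` by `σ_r
x_h` is exactly the removal of a term of weight above `τ`. -/
theorem value_edge_source {k : ℕ} (P : Pruned n k) (G : DAG n k) {τ : WithTop ℝ} (s : ℤˣ)
    (i : Fin n) (h : ((w (Ch.head i) : ℝ) : WithTop ℝ) ≤ τ) (x : Fin n → ℝ) (δ : ℕ → ℝ)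
    (v : Fin P.size → ℝ) :
    (P.edge Ch w τ (.source s i)).value x v =
      eval (Sum.elim (Ch.toNew x) δ) (truncate (wt w) τ (G.formalEdge Ch (.source s i))) := by
  classical
  rw [DAG.formalEdge_source, truncate_C_mul, formalInput_eq, Pruned.edge]
  by_cases hi : Ch.head i = i
  · rw [hi] at h
    rw [if_pos hi, truncate_X, wt_inl, if_pos h, if_pos h]
    simp [Operand.value, StdChange.toNew, hi]
  · rw [if_neg hi, truncate_add, truncate_C_mul, truncate_X, truncate_X, wt_inl,
      wt_inl, if_pos h]
    split_ifs
    · simp [Operand.value, StdChange.toNew, hi, Ch.head_head]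
    · simp [Operand.value, StdChange.toNew, Ch.head_head, mul_assoc]

/-- The redirected nodes in `L` carry the leading parts of their formal values. -/
def Pruned.Tracks {k : ℕ} (P : Pruned n k) (Ch : StdChange n) (w : Fin n → ℝ) (G : DAG n k)
    (L : Set (Fin k)) (x : Fin n → ℝ) (δ' δ : ℕ → ℝ) : Prop :=
  ∀ j ∈ L, (P.redirect j).value x (P.dag.values x δ') =
    eval (Sum.elim (Ch.toNew x) δ) (leadPart w (G.formalValues Ch j))

/-! ### Correctness of redirected edges and of a single pruning step -/

section Tracks

variable {k : ℕ} {P : Pruned n k} {G : DAG n k} {L : Set (Fin k)} {x : Fin n → ℝ} {δ' δ : ℕ → ℝ}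

theorem Pruned.Tracks.value_edge_node (h : P.Tracks Ch w G L x δ' δ) (τ : WithTop ℝ) (s : ℤˣ)
    {j : Fin k} (hj : j ∈ L) :
    (P.edge Ch w τ (.node s j)).value x (P.dag.values x δ') =
      eval (Sum.elim (Ch.toNew x) δ) (leadPart w (G.formalEdge Ch (.node s j))) := by
  rw [Pruned.edge, Operand.value_signed, h j hj, DAG.formalEdge_node, leadPart_C_mul, map_mul,
    eval_C]

theorem Pruned.Tracks.value_edge (hw : ExpCond Ch w) (h : P.Tracks Ch w G L x δ' δ)
    (a : Operand n k) (ha : a.nodes ⊆ L) :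
    (P.edge Ch w (tOrder w (G.formalEdge Ch a)) a).value x (P.dag.values x δ') =
      eval (Sum.elim (Ch.toNew x) δ) (leadPart w (G.formalEdge Ch a)) := by
  cases a with
  | source s i => exact value_edge_source P G s i (le_tOrder_formalEdge_source hw G s i) x δ _
  | node s j => exact h.value_edge_node _ s (ha rfl)

theorem Pruned.edge_signed (P : Pruned n k) (τ : WithTop ℝ) (s : ℤˣ) (a : Operand n k) :
    P.edge Ch w τ (a.signed s) = (P.edge Ch w τ a).signed s := by
  cases a with
  | source s' i =>
    simp only [Pruned.edge, Operand.signed]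
    split_ifs <;> simp [mul_assoc]
  | node s' j =>
    simp only [Pruned.edge, Operand.signed]
    cases P.redirect j <;> simp [mul_assoc]

/-- A kept addition of two inputs of equal order computes the leading part of the sum. -/
theorem Pruned.Tracks.value_edge_add (hw : ExpCond Ch w) (h : P.Tracks Ch w G L x δ' δ)
    (a b : Operand n k) (ha : a.nodes ⊆ L) (hb : b.nodes ⊆ L)
    (he : tOrder w (G.formalEdge Ch a) = tOrder w (G.formalEdge Ch b)) {γ : WithTop ℝ}
    (hγ : γ = tOrder w (G.formalEdge Ch a + G.formalEdge Ch b)) :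
    (P.edge Ch w γ a).value x (P.dag.values x δ') +
      (P.edge Ch w γ b).value x (P.dag.values x δ') =
      eval (Sum.elim (Ch.toNew x) δ)
        (leadPart w (G.formalEdge Ch a + G.formalEdge Ch b)) := by
  -- Without cancellation `γ` is the common order of the inputs, so all three leading parts are
  -- truncations at `γ`, and truncation is additive.
  have noCancel : tOrder w (G.formalEdge Ch a + G.formalEdge Ch b) =
      tOrder w (G.formalEdge Ch a) → (P.edge Ch w γ a).value x (P.dag.values x δ') +
      (P.edge Ch w γ b).value x (P.dag.values x δ') =
      eval (Sum.elim (Ch.toNew x) δ)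
        (leadPart w (G.formalEdge Ch a + G.formalEdge Ch b)) := by
    intro hs
    have h₁ := h.value_edge hw a ha
    have h₂ := h.value_edge hw b hb
    rw [leadPart] at h₁ h₂
    rw [← he] at h₂
    rw [hγ, leadPart, hs, h₁, h₂, truncate_add, map_add]
  cases a with
  | source s i =>
    cases b with
    | source s' i' =>
      -- Leading terms of two sources may cancel. Both are truncated at the order `γ` of the sum,
      -- which is still at least the weight of either representative.
      have hle := le_tOrder_add (le_tOrder_formalEdge_source hw G s i)
        (he ▸ le_tOrder_formalEdge_source hw G s i)
      have hle' := le_tOrder_add (he ▸ le_tOrder_formalEdge_source hw G s' i')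
        (le_tOrder_formalEdge_source hw G s' i')
      rw [value_edge_source P G s i (hγ ▸ hle) x δ, value_edge_source P G s' i' (hγ ▸ hle') x δ,
        leadPart, ← hγ, truncate_add, map_add]
    | node s' j' =>
      refine noCancel ?_
      rw [add_comm, he]
      exact tOrder_add_of_freeOf (eval_formalEdge_node_eq_zero Ch G s' j')
        (freeOf_formalEdge_source Ch G s i) he.symm
  | node s j =>
    cases b with
    | source s' i' =>
      exact noCancel (tOrder_add_of_freeOf (eval_formalEdge_node_eq_zero Ch G s j)
        (freeOf_formalEdge_source Ch G s' i') he)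
    | node s' j' =>
      -- Of two distinct nodes, the later one supplies the error that the earlier one does not
      -- involve.
      rcases lt_trichotomy j j' with hj | rfl | hj
      · refine noCancel ?_
        rw [add_comm, he]
        exact tOrder_add_of_freeOf (eval_formalEdge_node_eq_zero Ch G s' j')
          (freeOf_formalEdge_node Ch G s j hj) he.symm
      -- Both inputs are multiples of one value; scalars pass through `leadPart`, even if they add
      -- up to 0.
      · rw [h.value_edge_node _ s (ha rfl), h.value_edge_node _ s' (hb rfl)]
        simp only [DAG.formalEdge_node]
        rw [← add_mul, ← C_add, leadPart_C_mul, leadPart_C_mul, leadPart_C_mul]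
        simp [add_mul]
      · exact noCancel (tOrder_add_of_freeOf (eval_formalEdge_node_eq_zero Ch G s j)
          (freeOf_formalEdge_node Ch G s' j' hj) he)

theorem Pruned.Tracks.mono (h : P.Tracks Ch w G L x δ' δ) {L' : Set (Fin k)} (hL : L' ⊆ L) :
    P.Tracks Ch w G L' x δ' δ := fun j hj => h j (hL hj)

theorem elim_update (y : Fin n → ℝ) (δ : ℕ → ℝ) (l : ℕ) (c : ℝ) :
    (Sum.elim y (Function.update δ l c) : Fin n ⊕ ℕ → ℝ) =
      Function.update (Sum.elim y δ) (Sum.inr l) c := by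
  funext i
  cases i <;> simp [Function.update_apply]

/-- Deleting the next node is correct when its out-edges are redirected to its leading part. -/
theorem Pruned.Tracks.delete (o : Op) (a b : Operand n k) {L' : Set (Fin (k + 1))}
    (h : P.Tracks Ch w G {j | j.castSucc ∈ L'} x δ' δ) (c : Operand n P.size)
    (hc : Fin.last k ∈ L' → c.value x (P.dag.values x δ') = eval (Sum.elim (Ch.toNew x) δ)
      (leadPart w (o.apply (G.formalEdge Ch a) (G.formalEdge Ch b))))
    (hfree : FreeOf k (o.apply (G.formalEdge Ch a) (G.formalEdge Ch b))) :
    (P.delete c).Tracks Ch w (G.snoc o a b) L' x δ' (Function.update δ k 0) := by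
  intro j
  refine Fin.lastCases (fun hj => ?_) (fun j hj => ?_) j
  -- Error 0 turns the rounding factor of the deleted node into 1; no earlier value involves error
  -- `k`.
  · rw [DAG.formalValues_snoc_last, leadPart_mul_one_add_X, elim_update, map_mul,
      hfree.leadPart]
    simp only [Pruned.delete, Fin.snoc_last, hc hj, map_add, map_one, eval_X,
      Function.update_self, add_zero, mul_one]
  · rw [DAG.formalValues_snoc_castSucc, elim_update, (freeOf_formalValues Ch G j j.2).leadPart]
    simp only [Pruned.delete, Fin.snoc_castSucc]
    exact h j hj

/-- Keeping the next node is correct when its inputs give its leading part. -/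
theorem Pruned.Tracks.keep (o : Op) (a b : Operand n k) {L' : Set (Fin (k + 1))}
    (h : P.Tracks Ch w G {j | j.castSucc ∈ L'} x δ' δ) (a' b' : Operand n P.size)
    (hc : o.apply (a'.value x (P.dag.values x δ')) (b'.value x (P.dag.values x δ')) =
      eval (Sum.elim (Ch.toNew x) δ)
        (leadPart w (o.apply (G.formalEdge Ch a) (G.formalEdge Ch b))))
    (hfree : FreeOf k (o.apply (G.formalEdge Ch a) (G.formalEdge Ch b))) :
    (P.keep o a' b').Tracks Ch w (G.snoc o a b) L' x δ'
      (Function.update δ k (δ' P.size)) := by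
  intro j
  refine Fin.lastCases (fun _ => ?_) (fun j hj => ?_) j
  -- The kept node has number `P.size` in the pruned graph and number `k` in the original one, so
  -- error `k` is set to `δ' P.size`.
  · rw [DAG.formalValues_snoc_last, leadPart_mul_one_add_X, elim_update, map_mul,
      hfree.leadPart, ← hc]
    simp only [Pruned.keep, Fin.snoc_last, Operand.value, DAG.values_snoc_last, map_add,
      map_one, eval_X, Function.update_self, Units.val_one, Int.cast_one, one_mul]
  · rw [DAG.formalValues_snoc_castSucc, elim_update, (freeOf_formalValues Ch G j j.2).leadPart]
    simp only [Pruned.keep, Fin.snoc_castSucc, Operand.value_lift,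
      DAG.values_snoc_comp_castSucc]
    exact h j hj

end Tracks

/-! ### Correctness of pruning a whole graph -/

theorem freeOf_apply {k : ℕ} (o : Op) (G : DAG n k) (a b : Operand n k) :
    FreeOf k (o.apply (G.formalEdge Ch a) (G.formalEdge Ch b)) := by
  intro z c
  simp only [Op.map_apply, freeOf_formalEdge Ch G a z c, freeOf_formalEdge Ch G b z c]

theorem abs_update_le {δ : ℕ → ℝ} {ε c : ℝ} (h : ∀ i, |δ i| ≤ ε) (hc : |c| ≤ ε) (l : ℕ) :
    ∀ i, |Function.update δ l c i| ≤ ε := by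
  intro i
  by_cases hi : i = l
  · subst hi
    simpa using hc
  · simpa [hi] using h i

/-- Negation of an edge is exact, so subtraction reduces to the analysis of addition. -/
theorem sub_formalEdge {k : ℕ} (G : DAG n k) (a b : Operand n k) :
    G.formalEdge Ch a - G.formalEdge Ch b =
      G.formalEdge Ch a + G.formalEdge Ch (b.signed (-1)) := by
  simp [DAG.formalEdge_signed, sub_eq_add_neg]

theorem tOrder_formalEdge_signed {k : ℕ} (G : DAG n k) (s : ℤˣ) (a : Operand n k) :
    tOrder w (G.formalEdge Ch (a.signed s)) = tOrder w (G.formalEdge Ch a) := by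
  rw [DAG.formalEdge_signed, tOrder_C_mul (intUnit_cast_ne_zero s)]

theorem nodes_signed {k : ℕ} (s : ℤˣ) (a : Operand n k) : (a.signed s).nodes = a.nodes := by
  cases a <;> rfl

theorem edgeOrder_snoc_last {k : ℕ} (G : DAG n k) (o : Op) (a b : Operand n k) :
    (G.snoc o a b).edgeOrder Ch w (.node 1 (Fin.last k)) =
      tOrder w (o.apply (G.formalEdge Ch a) (G.formalEdge Ch b)) := by
  rw [← tOrder_mul_one_add_X _ k, ← DAG.formalValues_snoc_last, DAG.edgeOrder]
  simp [Operand.value]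

/-- For any errors in the pruned graph there are errors in the original graph, with the same bound,
for which the pruned graph computes the leading parts of the original values. -/
theorem DAG.exists_prune_tracks (hw : ExpCond Ch w) (x : Fin n → ℝ) {ε : ℝ} {δ' : ℕ → ℝ}
    (hδ' : ∀ i, |δ' i| ≤ ε) {k : ℕ} (G : DAG n k) (L : Set (Fin k)) :
    ∃ δ : ℕ → ℝ, (∀ i, |δ i| ≤ ε) ∧ (G.prune Ch w L).Tracks Ch w G L x δ' δ := by
  have hε : |(0 : ℝ)| ≤ ε := by
    rw [abs_zero]
    exact (abs_nonneg _).trans (hδ' 0)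
  induction G with
  | empty => exact ⟨δ', hδ', fun j => j.elim0⟩
  | @snoc k G o a b ih =>
    set L₀ : Set (Fin k) := {j | j.castSucc ∈ L}
    by_cases hL : Fin.last k ∈ L
    swap
    · obtain ⟨δ, hδ, h⟩ := ih L₀
      refine ⟨_, abs_update_le hδ hε k, ?_⟩
      simp only [DAG.prune, if_neg hL]
      exact h.delete o a b _ (fun h' => absurd h' hL) (freeOf_apply o G a b)
    -- The dominating input is `c`, while `d` is the edge whose nodes are marked as needed. They
    -- differ only when `c` is the negated subtrahend.
    have del : ∀ c d : Operand n k, leadPart w (o.apply (G.formalEdge Ch a) (G.formalEdge Ch b)) =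
        leadPart w (G.formalEdge Ch c) → d.nodes = c.nodes → ∃ δ : ℕ → ℝ, (∀ i, |δ i| ≤ ε) ∧
        ((G.prune Ch w (L₀ ∪ d.nodes)).delete ((G.prune Ch w (L₀ ∪ d.nodes)).edge Ch w
          (tOrder w (G.formalEdge Ch c)) c)).Tracks Ch w (G.snoc o a b) L x δ' δ := by
      intro c d hc hd
      obtain ⟨δ, hδ, h⟩ := ih (L₀ ∪ d.nodes)
      refine ⟨_, abs_update_le hδ hε k, (h.mono Set.subset_union_left).delete o a b _
        (fun _ => ?_) (freeOf_apply o G a b)⟩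
      rw [hc]
      exact h.value_edge hw c (hd ▸ Set.subset_union_right)
    obtain ⟨δ, hδ, h⟩ := ih (L₀ ∪ a.nodes ∪ b.nodes)
    have ha : a.nodes ⊆ L₀ ∪ a.nodes ∪ b.nodes :=
      Set.subset_union_right.trans Set.subset_union_left
    have hb : b.nodes ⊆ L₀ ∪ a.nodes ∪ b.nodes := Set.subset_union_right
    have h₀ := h.mono (Set.subset_union_left.trans Set.subset_union_left : L₀ ⊆ _)
    have hγ := edgeOrder_snoc_last (Ch := Ch) (w := w) G o a b
    have hδk := abs_update_le hδ (hδ' (G.prune Ch w (L₀ ∪ a.nodes ∪ b.nodes)).size) k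
    cases o with
    | mul =>
      refine ⟨_, hδk, ?_⟩
      simp only [DAG.prune, if_pos hL]
      refine h₀.keep .mul a b _ _ ?_ (freeOf_apply .mul G a b)
      simp only [Op.apply, leadPart_mul, map_mul]
      exact congrArg₂ _ (h.value_edge hw a ha) (h.value_edge hw b hb)
    | add =>
      simp only [DAG.prune, if_pos hL]
      split_ifs with h₁ h₂
      · exact del a a (leadPart_add_of_lt h₁) rfl
      · refine del b b ?_ rfl
        rw [Op.apply, add_comm]
        exact leadPart_add_of_lt h₂
      · refine ⟨_, hδk, h₀.keep .add a b _ _ ?_ (freeOf_apply .add G a b)⟩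
        exact h.value_edge_add hw a b ha hb (le_antisymm (not_lt.1 h₂) (not_lt.1 h₁)) hγ
    | sub =>
      rw [Op.apply, sub_formalEdge] at hγ
      simp only [DAG.prune, if_pos hL]
      split_ifs with h₁ h₂
      · refine del a a ?_ rfl
        rw [Op.apply, sub_formalEdge]
        exact leadPart_add_of_lt (by rw [tOrder_formalEdge_signed]; exact h₁)
      · have := del (b.signed (-1)) b ?_ (nodes_signed _ _).symm
        · rw [tOrder_formalEdge_signed, Pruned.edge_signed] at this
          exact this
        · rw [Op.apply, sub_formalEdge, add_comm]
          exact leadPart_add_of_lt (by rw [tOrder_formalEdge_signed]; exact h₂)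
      · refine ⟨_, hδk, h₀.keep .sub a b _ _ ?_ (freeOf_apply .sub G a b)⟩
        have hs := h.value_edge_add hw a (b.signed (-1)) ha (by rwa [nodes_signed])
          (by rw [tOrder_formalEdge_signed]; exact le_antisymm (not_lt.1 h₂) (not_lt.1 h₁)) hγ
        rw [Op.apply, Op.apply, sub_formalEdge, ← hs, Pruned.edge_signed, Operand.value_signed]
        rw [Units.val_neg, Units.val_one, Int.cast_neg, Int.cast_one, neg_one_mul,
          ← sub_eq_add_neg]

/-- For any errors in the pruned algorithm there are errors in the original one, with the same
bound, for which the pruned algorithm computes the leading part of the original output. -/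
theorem Algorithm.exists_prune_comp_eq (A : Algorithm n) (hw : ExpCond Ch w) (x : Fin n → ℝ)
    {ε : ℝ} {δ' : ℕ → ℝ} (hδ' : ∀ i, |δ' i| ≤ ε) :
    ∃ δ : ℕ → ℝ, (∀ i, |δ i| ≤ ε) ∧ (A.prune Ch w).comp x δ' =
      eval (Sum.elim (Ch.toNew x) δ) (leadPart w (A.dag.formalEdge Ch A.out)) := by
  obtain ⟨δ, hδ, h⟩ := A.dag.exists_prune_tracks hw x hδ' A.out.nodes
  exact ⟨δ, hδ, h.value_edge hw A.out subset_rfl⟩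

/-! ### Dominant terms -/

theorem eval_aeval {σ τ : Type*} (g : σ → MvPolynomial τ ℝ) (p : MvPolynomial σ ℝ) (z : τ → ℝ) :
    eval z (aeval g p) = eval (fun i => eval z (g i)) p := by
  have h : (eval z).comp (algebraMap ℝ (MvPolynomial τ ℝ)) = RingHom.id ℝ :=
    RingHom.ext fun c => by simp [algebraMap_eq]
  rw [map_aeval, h]
  rfl

theorem eval_newPoly (Ch : StdChange n) (p : MvPolynomial (Fin n) ℝ) (y : Fin n → ℝ) :
    eval y (Ch.newPoly p) = eval (Ch.toOld y) p := by
  have : (fun i => eval y (Ch.toOld (X : Fin n → MvPolynomial (Fin n) ℝ) i)) = Ch.toOld y := by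
    funext i
    rw [StdChange.map_toOld]
    simp
  rw [StdChange.newPoly, eval_aeval, this]

theorem eval_oldPoly (Ch : StdChange n) (q : MvPolynomial (Fin n) ℝ) (x : Fin n → ℝ) :
    eval x (Ch.oldPoly q) = eval (Ch.toNew x) q := by
  have : (fun i => eval x (Ch.toNew (X : Fin n → MvPolynomial (Fin n) ℝ) i)) = Ch.toNew x := by
    funext i
    rw [StdChange.map_toNew]
    simp
  rw [StdChange.oldPoly, eval_aeval, this]

theorem weight_extend {K : Finset (Fin n)} (η : K → ℝ) (m : Fin n →₀ ℕ) :
    Finsupp.weight (extend η) m = ∑ i, η i * (expo K m i : ℝ) := by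
  rw [Finsupp.weight_eq_sum, ← Finset.sum_subset (Finset.subset_univ K), ← Finset.sum_coe_sort K]
  · refine Finset.sum_congr rfl fun i _ => ?_
    simp [extend, expo, mul_comm]
  · intro i _ hi
    simp [extend, hi]

/-- The terms of `q` in the dominant set are those of lowest weight. -/
theorem exists_truncate_eq_domPart {K : Finset (Fin n)} {q : MvPolynomial (Fin n) ℝ}
    {Λj : Finset (K → ℕ)} (hsub : Λj ⊆ exponents K q) (hne : Λj.Nonempty) {η : K → ℝ}
    (hη : η ∈ region K q Λj) :
    ∃ μ : ℝ, (∀ m ∈ q.support, μ ≤ Finsupp.weight (extend η) m) ∧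
      truncate (extend η) μ q = domPart K q Λj ∧ domPart K q Λj ≠ 0 := by
  classical
  obtain ⟨-, heq, hlt⟩ := hη
  obtain ⟨l, hl⟩ := hne
  have hin : ∀ m, expo K m ∈ Λj →
      Finsupp.weight (extend η) m = ∑ i, η i * (l i : ℝ) := fun m hm => by
    rw [weight_extend, heq _ hm _ hl]
  have hout : ∀ m ∈ q.support, expo K m ∉ Λj →
      ∑ i, η i * (l i : ℝ) < Finsupp.weight (extend η) m := fun m hm h => by
    rw [weight_extend]
    exact hlt _ hl _ (Finset.mem_sdiff.2 ⟨Finset.mem_image_of_mem _ hm, h⟩)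
  have heq' : truncate (extend η) ((∑ i, η i * (l i : ℝ) : ℝ) : WithTop ℝ) q =
      domPart K q Λj := by
    rw [truncate, domPart]
    refine Finset.sum_congr (Finset.filter_congr fun m hm => ?_) fun _ _ => rfl
    rw [WithTop.coe_le_coe]
    refine ⟨fun h => ?_, fun h => (hin m h).le⟩
    by_contra hm'
    exact (hout m hm hm').not_ge h
  refine ⟨∑ i, η i * (l i : ℝ), fun m hm => ?_, heq', ?_⟩
  · by_cases h : expo K m ∈ Λj
    · exact (hin m h).ge
    · exact (hout m hm h).le
  · obtain ⟨m, hm, hml⟩ := Finset.mem_image.1 (hsub hl)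
    rw [← heq', ne_zero_iff]
    refine ⟨m, ?_⟩
    rw [coeff_truncate, if_pos (WithTop.coe_le_coe.2 (hin m (hml ▸ hl)).le)]
    exact mem_support_iff.1 hm

theorem scale_elim (w : Fin n → ℝ) (t : ℝ) (y : Fin n → ℝ) (δ : ℕ → ℝ) :
    scale (wt w) t (Sum.elim y δ) = Sum.elim (scale w t y) δ := by
  funext i
  cases i <;> simp [scale]

/-- If `f` is a relatively accurate approximation of `q` for all small errors, then its leading part
is a relatively accurate approximation of the leading part of `q`. -/
theorem abs_leadPart_sub_le {w : Fin n → ℝ} {q : MvPolynomial (Fin n) ℝ} {μ : ℝ}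
    (hq : ∀ m ∈ q.support, μ ≤ Finsupp.weight w m) (hq0 : truncate w μ q ≠ 0)
    {f : MvPolynomial (Fin n ⊕ ℕ) ℝ} {θ ε : ℝ} (hθ1 : θ < 1) (hε : 0 < ε)
    (hacc : ∀ y : Fin n → ℝ, ∀ δ : ℕ → ℝ, (∀ i, |δ i| ≤ ε) →
      |eval (Sum.elim y δ) f - eval y q| ≤ θ * |eval y q|)
    (y : Fin n → ℝ) {δ : ℕ → ℝ} (hδ : ∀ i, |δ i| ≤ ε) :
    |eval (Sum.elim y δ) (leadPart w f) - eval y (truncate w μ q)| ≤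
      θ * |eval y (truncate w μ q)| := by
  -- The accuracy inequality at the scaled point, multiplied by `t ^ (-μ)`, passes to the limit.
  have hlim : ∀ F, HasLead w f μ F → ∀ y : Fin n → ℝ, ∀ δ : ℕ → ℝ, (∀ i, |δ i| ≤ ε) →
      |eval (Sum.elim y δ) F - eval y (truncate w μ q)| ≤ θ * |eval y (truncate w μ q)| := by
    intro F hF y δ hδ
    have hqt := tendsto_eval_scale w q μ hq y
    refine le_of_tendsto_of_tendsto ((hF (Sum.elim y δ)).sub hqt).abs (hqt.abs.const_mul θ) ?_
    filter_upwards [self_mem_nhdsWithin] with t (ht : 0 < t)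
    have h := mul_le_mul_of_nonneg_left (hacc (scale w t y) δ hδ) (Real.rpow_pos_of_pos ht (-μ)).le
    rw [← mul_sub, abs_mul, abs_mul, abs_of_pos (Real.rpow_pos_of_pos ht (-μ)), scale_elim]
    linarith
  -- If the output were negligible against `q`, the limit would give `|Q| ≤ θ |Q|` for the leading
  -- part `Q` of `q`, so `Q = 0` because `θ < 1`.
  have hnot : ¬ HasLead w f μ 0 := by
    intro h0
    refine hq0 (MvPolynomial.funext fun y => ?_)
    have := hlim 0 h0 y 0 (by simp [hε.le])
    rw [map_zero, zero_sub, abs_neg] at this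
    rw [map_zero, ← abs_eq_zero]
    nlinarith [abs_nonneg (eval y (truncate w μ q))]
  have hf : f ≠ 0 := by
    rintro rfl
    exact hnot hasLead_zero
  obtain ⟨ν, -, hν⟩ := exists_hasLead (w := w) hf
  rcases lt_trichotomy ν μ with hlt | rfl | hgt
  -- If the output had order `ν < μ`, then `t ^ (-ν) * q` would tend to 0, forcing the leading part
  -- of the output to vanish for all `y` and all errors in `[-ε, ε]`. A polynomial vanishing on a
  -- product of infinite sets is zero.
  · exfalso
    refine leadPart_ne_zero w hf (MvPolynomial.funext_set
      (Sum.elim (fun _ => Set.univ) fun _ => Set.Icc (-ε) ε) ?_ fun z hz => ?_)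
    · rintro (i | l)
      · exact Set.infinite_univ
      · exact Set.Icc_infinite (by linarith)
    · obtain ⟨y, δ, rfl⟩ : ∃ y δ, z = Sum.elim y δ :=
        ⟨_, _, (Sum.elim_comp_inl_inr z).symm⟩
      have hδ' : ∀ i, |δ i| ≤ ε := fun i => abs_le.2 (by simpa using hz (Sum.inr i) trivial)
      have hqt := (tendsto_rpow_nhdsGT_zero (sub_pos.2 hlt)).mul
        (tendsto_eval_scale w q μ hq y)
      rw [zero_mul] at hqt
      have hle : |eval (Sum.elim y δ) (leadPart w f) - 0| ≤ θ * |(0 : ℝ)| := by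
        refine le_of_tendsto_of_tendsto ((hν (Sum.elim y δ)).sub hqt).abs
          (hqt.abs.const_mul θ) ?_
        filter_upwards [self_mem_nhdsWithin] with t (ht : 0 < t)
        have h := mul_le_mul_of_nonneg_left (hacc (scale w t y) δ hδ')
          (Real.rpow_pos_of_pos ht (-ν)).le
        rw [← mul_assoc (t ^ (μ - ν)), ← Real.rpow_add ht,
          show μ - ν + -μ = -ν by ring, ← mul_sub, abs_mul, abs_mul,
          abs_of_pos (Real.rpow_pos_of_pos ht (-ν)), scale_elim]
        linarith
      rw [abs_zero, mul_zero, sub_zero] at hle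
      rw [map_zero]
      exact abs_nonpos_iff.1 hle
  · exact hlim _ hν y δ hδ
  · exact absurd (hν.lower hgt) hnot

/-- Pruning an accurate algorithm gives an accurate algorithm for the dominant term. -/
theorem Algorithm.IsAccurate.prune {A : Algorithm n} {p : MvPolynomial (Fin n) ℝ}
    (hA : A.IsAccurate p Set.univ) (Ch : StdChange n) {K : Finset (Fin n)} {Λj : Finset (K → ℕ)}
    (hsub : Λj ⊆ exponents K (Ch.newPoly p)) (hne : Λj.Nonempty) {η : K → ℝ}
    (hη : η ∈ region K (Ch.newPoly p) Λj) (hw : ExpCond Ch (extend η)) :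
    (A.prune Ch (extend η)).IsAccurate (domTerm p Ch K Λj) Set.univ := by
  obtain ⟨μ, hμ, hdom, hdom0⟩ := exists_truncate_eq_domPart hsub hne hη
  intro θ hθ hθ1
  obtain ⟨ε, hε, hε1, hacc⟩ := hA θ hθ hθ1
  -- The bound `ε` for the original algorithm serves unchanged, since the errors pulled back from
  -- the pruned one obey it.
  refine ⟨ε, hε, hε1, fun x _ δ' hδ' => ?_⟩
  obtain ⟨δ, hδ, hcomp⟩ := A.exists_prune_comp_eq hw x hδ'
  rw [hcomp, domTerm, eval_oldPoly, ← hdom]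
  refine abs_leadPart_sub_le hμ (hdom ▸ hdom0) hθ1 hε (fun y δ hδ => ?_) _ hδ
  rw [DAG.eval_formalEdge, eval_newPoly]
  exact hacc (Ch.toOld y) trivial δ hδ

end AccurateEval

open AccurateEval in
theorem mainTheorem5 {n : ℕ} (p : MvPolynomial (Fin n) ℝ) :
    (∀ A : Algorithm n, A.IsAccurate p Set.univ →
      ∀ (Z : Set (Fin n → ℝ)) (C : StdChange n) (K : Finset (Fin n)),
        IsIrreducibleComponent p Z → C.Straightens Z K →
      ∀ Λj : Finset (K → ℕ), IsDominantSet K (C.newPoly p) Λj →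
      ∀ η ∈ region K (C.newPoly p) Λj, ExpCond C (extend η) →
        (A.prune C (extend η)).IsAccurate (domTerm p C K Λj) Set.univ) ∧
    (AccuratelyEvaluable p Set.univ →
      ∀ (Z : Set (Fin n → ℝ)) (C : StdChange n) (K : Finset (Fin n)),
        IsIrreducibleComponent p Z → C.Straightens Z K →
      ∀ Λj : Finset (K → ℕ), IsDominantSet K (C.newPoly p) Λj →
        (∃ η ∈ region K (C.newPoly p) Λj, ExpCond C (extend η)) →
        AccuratelyEvaluable (domTerm p C K Λj) Set.univ) := by
  refine ⟨fun A hA Z C K _ _ Λj hΛ η hη hw => hA.prune C hΛ.1 hΛ.2.1 hη hw, ?_⟩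
  rintro ⟨A, hA⟩ Z C K _ _ Λj hΛ ⟨η, hη, hw⟩
  exact ⟨_, hA.prune C hΛ.1 hΛ.2.1 hη hw⟩
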